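/- Conventions. All distances below take values in $[0,\infty]$. For a point $a$ and a non-empty subset $B$ of a (pseudo)metric space, $|aB|=\inf_{b\in B}|ab|$. The oriented Hausdorff distance from $A$ to $B$ is $\overrightarrow{d_H}(A,B)=\sup_{a\in A}|aB|$ (equal to $0$ if $A=\emptyset$), and the Hausdorff distance between non-empty $A$ and $B$ is $d_H(A,B)=\max\{\overrightarrow{d_H}(A,B),\overrightarrow{d_H}(B,A)\}$. A correspondence between non-empty (pseudo)metric spaces $X$ and $Y$ is a relation $R\subset X\times Y$ whose projections to $X$ and to $Y$ are both surjective; its distortion is $\operatorname{dis}R=\sup\{||xx'|-|yy'||:(x,y),(x',y')\in R\}$, and the Gromov--Hausdorff distance is $d_{GH}(X,Y)=\frac12\inf_R\operatorname{dis}R$ over all correspondences $R$. Metric trees. Let $\{e_\alpha\}_{\alpha\in I}$ be an arbitrary (possibly infinite) family of non-degenerate segments of the real line, and let $\sim$ be an equivalence relation on $\bigsqcup_\alpha e_\alpha$ that identifies some endpoints of the segments and nothing else. The quotient is a graph whose edges are the images of the segments and whose vertices are the images of their endpoints. If this graph is connected and has no cycles (in particular no loops and no multiple edges), then the quotient, with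 the intrinsic (pseudo)metric in which the distance between two points is the infimum of the lengths of the finite broken lines along edges joining them, is called a metric tree. Let $T$ be a metric tree and $X\subset T$ a non-empty subset. A point $a\in T\setminus X$ is internal with respect to $X$ if there is a path in $T$ (a topological embedding of a segment) with both ends in $X$ that passes through $a$. Let $\partial_XT$ be the set of all points of $T\setminus X$ that are not internal with respect to $X$. Theorem. Let $T$ be an arbitrary metric tree, not necessarily finite, and let $X$ be a non-empty subset of $T$, with the induced distance. Suppose that either $\partial_XT=\emptyset$, or $\partial_XT\neq\emptyset$ and $d_H(X,T)>\overrightarrow{d_H}(\partial_XT,X)$. Then $$d_{GH}(X,T)=d_H(X,T),$$ where both sides may be infinite. -/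

import Mathlib

universe u v

/-- A graph glued from a family of non-degenerate segments `[left i, right i]` of the real line:
`glue` is an equivalence relation on their disjoint union that identifies some ends of
the segments and nothing else. -/
structure GluedGraph (I : Type u) where
  left : I → ℝ
  right : I → ℝ
  left_lt_right : ∀ i, left i < right i
  glue : Setoid (Σ i, Set.Icc (left i) (right i))
  glue_ends : ∀ p q, glue p q → p ≠ q →
    ((p.2 : ℝ) = left p.1 ∨ (p.2 : ℝ) = right p.1) ∧
    ((q.2 : ℝ) = left q.1 ∨ (q.2 : ℝ) = right q.1)

namespace GluedGraph

variable {I : Type u} (G : GluedGraph I)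

/-- The set of points of the graph, the quotient of the disjoint union of the segments. -/
def Point : Type u := Quotient G.glue

/-- The image in the graph of the point `s` of the `i`-th segment. -/
def pt (i : I) (s : Set.Icc (G.left i) (G.right i)) : G.Point :=
  Quotient.mk G.glue ⟨i, s⟩

def leftEnd (i : I) : G.Point := G.pt i ⟨G.left i, le_refl _, (G.left_lt_right i).le⟩

def rightEnd (i : I) : G.Point := G.pt i ⟨G.right i, (G.left_lt_right i).le, le_refl _⟩

/-- The vertices are the images of the ends of the segments. -/
def Vertex : Type u := {x : G.Point // ∃ i, x = G.leftEnd i ∨ x = G.rightEnd i}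

/-- Distinct vertices are adjacent when they are the two ends of an edge. -/
def skeleton : SimpleGraph G.Vertex :=
  SimpleGraph.fromRel fun x y => ∃ i, x.1 = G.leftEnd i ∧ y.1 = G.rightEnd i

/-- The graph is connected and has no cycles: there are no loops (cycles of length one), no two
edges with the same ends (cycles of length two), and no cycles of length at least three. -/
structure IsTree : Prop where
  no_loop : ∀ i, G.leftEnd i ≠ G.rightEnd i
  no_multi : ∀ i j, s(G.leftEnd i, G.rightEnd i) = s(G.leftEnd j, G.rightEnd j) → i = j
  isTree_skeleton : G.skeleton.IsTree

/-- `G.Joined x y L`: there is a broken line of length `L` in `G` from `x` to `y`, i.e. a finite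
sequence of moves from `x` to `y`, each of them inside one edge, of total length `L`. -/
inductive Joined (x : G.Point) : G.Point → ℝ → Prop
  | refl : Joined x x 0
  | step (i : I) (s t : Set.Icc (G.left i) (G.right i)) (L : ℝ) :
      Joined x (G.pt i s) L → Joined x (G.pt i t) (L + dist s t)

variable {G}

theorem Joined.nonneg {x y : G.Point} {L : ℝ} (h : G.Joined x y L) : 0 ≤ L := by
  induction h with
  | refl => exact le_refl _
  | step i s t L _ ih => exact add_nonneg ih dist_nonneg

theorem Joined.trans {x y z : G.Point} {L M : ℝ} (h : G.Joined x y L) (h' : G.Joined y z M) :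
    G.Joined x z (L + M) := by
  induction h' with
  | refl => simpa using h
  | step i s t M _ ih => rw [← add_assoc]; exact Joined.step i s t _ ih

theorem Joined.edge (i : I) (s t : Set.Icc (G.left i) (G.right i)) :
    G.Joined (G.pt i s) (G.pt i t) (dist s t) := by
  simpa using Joined.step i s t 0 Joined.refl

theorem Joined.symm {x y : G.Point} {L : ℝ} (h : G.Joined x y L) : G.Joined y x L := by
  induction h with
  | refl => exact Joined.refl
  | step i s t L _ ih =>
    rw [add_comm, dist_comm]
    exact (Joined.edge i t s).trans ih

theorem exists_joined_of_preconnected (h : G.skeleton.Preconnected) (x y : G.Point) :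
    ∃ L, G.Joined x y L := by
  have hv : ∀ v w : G.Vertex, ∃ L, G.Joined v.1 w.1 L := by
    intro v w
    obtain ⟨p⟩ := h v w
    induction p with
    | nil => exact ⟨0, Joined.refl⟩
    | cons hadj _ ih =>
      obtain ⟨M, hM⟩ := ih
      rw [skeleton, SimpleGraph.fromRel_adj] at hadj
      obtain ⟨-, ⟨i, hi, hj⟩ | ⟨i, hi, hj⟩⟩ := hadj
      · have he := Joined.edge (G := G) i ⟨G.left i, le_refl _, (G.left_lt_right i).le⟩
          ⟨G.right i, (G.left_lt_right i).le, le_refl _⟩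
        change G.Joined (G.leftEnd i) (G.rightEnd i) _ at he
        rw [← hi, ← hj] at he
        exact ⟨_, he.trans hM⟩
      · have he := Joined.edge (G := G) i ⟨G.left i, le_refl _, (G.left_lt_right i).le⟩
          ⟨G.right i, (G.left_lt_right i).le, le_refl _⟩
        change G.Joined (G.leftEnd i) (G.rightEnd i) _ at he
        rw [← hi, ← hj] at he
        exact ⟨_, he.symm.trans hM⟩
  have hx : ∀ x : G.Point, ∃ (v : G.Vertex) (L : ℝ), G.Joined x v.1 L := by
    intro x
    induction x using Quotient.inductionOn with
    | h p => exact ⟨⟨G.leftEnd p.1, p.1, Or.inl rfl⟩, _, Joined.edge p.1 p.2 _⟩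
  obtain ⟨v, L, hL⟩ := hx x
  obtain ⟨w, M, hM⟩ := hx y
  obtain ⟨N, hN⟩ := hv v w
  exact ⟨_, (hL.trans hN).trans hM.symm⟩

end GluedGraph

/-- A metric tree: a connected graph without cycles, glued from segments. -/
structure MetricTree (I : Type u) extends GluedGraph I where
  isTree : toGluedGraph.IsTree

namespace MetricTree

variable {I : Type u} (T : MetricTree I)

/-- The set of points of the metric tree. -/
def Point : Type u := T.toGluedGraph.Point

/-- The intrinsic (pseudo)metric: the infimum of the lengths of the broken lines that join
two points. -/
noncomputable instance : PseudoMetricSpace T.Point where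
  dist x y := sInf {L | T.toGluedGraph.Joined x y L}
  dist_self x := le_antisymm
    (csInf_le ⟨0, fun _ h => h.nonneg⟩ GluedGraph.Joined.refl)
    (Real.sInf_nonneg fun _ h => h.nonneg)
  dist_comm x y := congrArg sInf (Set.ext fun _ => ⟨fun h => h.symm, fun h => h.symm⟩)
  dist_triangle x y z := by
    have ne := GluedGraph.exists_joined_of_preconnected T.isTree.isTree_skeleton.1.1
    have bb : ∀ a b, BddBelow {L | T.toGluedGraph.Joined a b L} :=
      fun a b => ⟨0, fun _ h => h.nonneg⟩
    refine le_of_forall_pos_le_add fun ε hε => ?_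
    obtain ⟨L, hL, hL'⟩ := exists_lt_of_csInf_lt (ne x y) (lt_add_of_pos_right _ (half_pos hε))
    obtain ⟨M, hM, hM'⟩ := exists_lt_of_csInf_lt (ne y z) (lt_add_of_pos_right _ (half_pos hε))
    have := csInf_le (bb x z) (GluedGraph.Joined.trans hL hM)
    change _ < sInf {L | T.toGluedGraph.Joined x y L} + _ at hL'
    change _ < sInf {L | T.toGluedGraph.Joined y z L} + _ at hM'
    linarith

variable {T}

/-- The points outside `X` that are internal with respect to `X`: they lie on a path in the tree
(a topological embedding of a segment) with both ends in `X`. -/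
def relInterior (X : Set T.Point) : Set T.Point :=
  {a | a ∉ X ∧ ∃ γ : unitInterval → T.Point,
    Topology.IsEmbedding γ ∧ γ 0 ∈ X ∧ γ 1 ∈ X ∧ a ∈ Set.range γ}

/-- The end points with respect to `X`: the points outside `X` that are not internal. -/
def relBoundary (X : Set T.Point) : Set T.Point := Xᶜ \ relInterior X

end MetricTree

/-- The oriented Hausdorff distance from `A` to `B`, with values in `[0, ∞]`;
it is `0` for empty `A`. -/
noncomputable def orientedHausdorffEDist {Z : Type u} [PseudoMetricSpace Z] (A B : Set Z) :
    ENNReal :=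
  ⨆ a ∈ A, Metric.infEDist a B

/-- A correspondence between `X` and `Y`: a multivalued surjective map, given by its graph. -/
def IsCorrespondence {X : Type u} {Y : Type v} (R : Set (X × Y)) : Prop :=
  (∀ x, ∃ y, (x, y) ∈ R) ∧ (∀ y, ∃ x, (x, y) ∈ R)

/-- The distortion of a relation, with values in `[0, ∞]`. -/
noncomputable def distortion {X : Type u} {Y : Type v} [PseudoMetricSpace X] [PseudoMetricSpace Y]
    (R : Set (X × Y)) : ENNReal :=
  ⨆ p ∈ R, ⨆ q ∈ R, ENNReal.ofReal |dist p.1 q.1 - dist p.2 q.2|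

/-- The Gromov-Hausdorff distance, with values in `[0, ∞]`. -/
noncomputable def gromovHausdorffEDist (X : Type u) (Y : Type v)
    [PseudoMetricSpace X] [PseudoMetricSpace Y] : ENNReal :=
  (⨅ (R : Set (X × Y)) (_ : IsCorrespondence R), distortion R) / 2

/-! Only the bound `d_GH ≥ d_H` is special to trees. Let `a` be internal, at distance `r` from `X`.
A path with ends in `X` runs through `a`, and `a` cuts the tree into two sides, each containing one
end (`exists_separation`). Travel between the sides goes through `a`, so points of `X` on different
sides are at least `2r` apart. If a correspondence had distortion below `2r`, the points of `T`
matched to one side of `X` would form a set stable under small neighbourhoods. A tree is connected,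
so this set would be all of `T`, and some point would be matched to both sides, which is impossible.
Hence `2r ≤ dis R` (`infEDist_mul_two_le_distortion`). Points of the relative boundary stay strictly
closer to `X` than `d_H`, so internal points alone force the bound. The separation comes from
retracting the tree onto one edge. -/

/-! ### Retraction of a tree onto an edge -/

namespace GluedGraph

variable {I : Type u} (G : GluedGraph I)

/-- The left end of an edge, as a vertex. -/
def leftVertex (i : I) : G.Vertex := ⟨G.leftEnd i, i, Or.inl rfl⟩

/-- The right end of an edge, as a vertex. -/
def rightVertex (i : I) : G.Vertex := ⟨G.rightEnd i, i, Or.inr rfl⟩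

/-- The skeleton without the edge `i`. -/
def skeletonWithout (i : I) : SimpleGraph G.Vertex :=
  G.skeleton.deleteEdges {s(G.leftVertex i, G.rightVertex i)}

open Classical in
/-- The end of the segment `i` to which a retraction onto the edge `i` sends a vertex. -/
noncomputable def vertexProj (i : I) (v : G.Vertex) : ℝ :=
  if (G.skeletonWithout i).Reachable (G.leftVertex i) v then G.left i else G.right i

open Classical in
/-- The retraction onto the edge `i`, on the disjoint union of the segments. -/
noncomputable def preProj (i : I) (p : Σ i, Set.Icc (G.left i) (G.right i)) : ℝ :=
  if p.1 = i then p.2 else G.vertexProj i (G.leftVertex p.1)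

variable {G}

theorem IsTree.skeleton_adj (hG : G.IsTree) (i : I) :
    G.skeleton.Adj (G.leftVertex i) (G.rightVertex i) := by
  rw [skeleton, SimpleGraph.fromRel_adj]
  exact ⟨fun h => hG.no_loop i (congrArg Subtype.val h), Or.inl ⟨i, rfl, rfl⟩⟩

/-- Every edge of an acyclic graph is a bridge. -/
theorem IsTree.not_reachable (hG : G.IsTree) (i : I) :
    ¬ (G.skeletonWithout i).Reachable (G.leftVertex i) (G.rightVertex i) := by
  have h := SimpleGraph.isAcyclic_iff_forall_adj_isBridge.1 hG.isTree_skeleton.2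
    (hG.skeleton_adj i)
  rw [SimpleGraph.isBridge_iff] at h
  exact h

theorem IsTree.skeletonWithout_adj (hG : G.IsTree) {i j : I} (hij : j ≠ i) :
    (G.skeletonWithout i).Adj (G.leftVertex j) (G.rightVertex j) := by
  rw [skeletonWithout, SimpleGraph.deleteEdges_adj]
  refine ⟨hG.skeleton_adj j, fun h => hij (hG.no_multi j i ?_)⟩
  exact congrArg (Sym2.map Subtype.val) (Set.mem_singleton_iff.1 h)

theorem IsTree.vertexProj_eq (hG : G.IsTree) {i j : I} (hij : j ≠ i) :
    G.vertexProj i (G.leftVertex j) = G.vertexProj i (G.rightVertex j) := by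
  have h := (hG.skeletonWithout_adj hij).reachable
  have : (G.skeletonWithout i).Reachable (G.leftVertex i) (G.leftVertex j) ↔
      (G.skeletonWithout i).Reachable (G.leftVertex i) (G.rightVertex j) :=
    ⟨fun h' => h'.trans h, fun h' => h'.trans h.symm⟩
  classical
  unfold vertexProj
  exact if_congr this rfl rfl

theorem mk_eq_end (p : Σ i, Set.Icc (G.left i) (G.right i))
    (hp : (p.2 : ℝ) = G.left p.1 ∨ (p.2 : ℝ) = G.right p.1) :
    (p.2 : ℝ) = G.left p.1 ∧ Quotient.mk G.glue p = G.leftEnd p.1 ∨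
      (p.2 : ℝ) = G.right p.1 ∧ Quotient.mk G.glue p = G.rightEnd p.1 := by
  obtain ⟨j, s⟩ := p
  rcases hp with h | h
  · exact Or.inl ⟨h, congrArg (G.pt j) (Subtype.ext h)⟩
  · exact Or.inr ⟨h, congrArg (G.pt j) (Subtype.ext h)⟩

/-- Only ends of segments are glued, so dependence on the vertex alone lets the retraction descend
to the quotient. -/
theorem IsTree.preProj_of_end (hG : G.IsTree) (i : I)
    (p : Σ i, Set.Icc (G.left i) (G.right i))
    (hp : (p.2 : ℝ) = G.left p.1 ∨ (p.2 : ℝ) = G.right p.1) (v : G.Vertex)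
    (hv : v.1 = Quotient.mk G.glue p) : G.preProj i p = G.vertexProj i v := by
  have key : (p.2 : ℝ) = G.left p.1 ∧ v = G.leftVertex p.1 ∨
      (p.2 : ℝ) = G.right p.1 ∧ v = G.rightVertex p.1 :=
    (mk_eq_end p hp).imp (fun h => ⟨h.1, Subtype.ext (hv.trans h.2)⟩)
      fun h => ⟨h.1, Subtype.ext (hv.trans h.2)⟩
  obtain ⟨j, s⟩ := p
  by_cases hji : j = i
  · subst hji
    obtain ⟨h, rfl⟩ | ⟨h, rfl⟩ := key
    · simpa [preProj, vertexProj] using h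
    · simpa [preProj, vertexProj, hG.not_reachable] using h
  · obtain ⟨-, rfl⟩ | ⟨-, rfl⟩ := key
    · simp [preProj, hji]
    · simp [preProj, hji, hG.vertexProj_eq hji]

/-- The retraction of a tree onto its edge `i`, as a function with values in the `i`-th segment. -/
noncomputable def IsTree.proj (hG : G.IsTree) (i : I) : G.Point → ℝ :=
  Quotient.lift (G.preProj i) fun p q h => by
    by_cases hpq : p = q
    · rw [hpq]
    obtain ⟨hp, hq⟩ := G.glue_ends p q h hpq
    have hv : ∃ j, Quotient.mk G.glue p = G.leftEnd j ∨ Quotient.mk G.glue p = G.rightEnd j :=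
      ⟨p.1, (mk_eq_end p hp).imp And.right And.right⟩
    rw [hG.preProj_of_end i p hp ⟨_, hv⟩ rfl,
      hG.preProj_of_end i q hq ⟨_, hv⟩ (Quotient.sound h)]

theorem IsTree.proj_pt_self (hG : G.IsTree) (i : I) (s : Set.Icc (G.left i) (G.right i)) :
    hG.proj i (G.pt i s) = s :=
  if_pos rfl

theorem IsTree.proj_pt_of_ne (hG : G.IsTree) {i j : I} (hij : j ≠ i)
    (s t : Set.Icc (G.left j) (G.right j)) :
    hG.proj i (G.pt j s) = hG.proj i (G.pt j t) :=
  (if_neg hij).trans (if_neg hij).symm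

theorem IsTree.exists_eq_pt_or (hG : G.IsTree) (i : I) (x : G.Point) :
    (∃ s : Set.Icc (G.left i) (G.right i), x = G.pt i s) ∨ hG.proj i x = G.left i ∨
      hG.proj i x = G.right i := by
  induction x using Quotient.inductionOn with
  | h p =>
    obtain ⟨j, s⟩ := p
    by_cases hji : j = i
    · subst hji
      exact Or.inl ⟨s, rfl⟩
    · right
      change G.preProj i ⟨j, s⟩ = _ ∨ G.preProj i ⟨j, s⟩ = _
      rw [preProj, if_neg hji, vertexProj]
      split_ifs
      · exact Or.inl rfl
      · exact Or.inr rfl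

/-- Everything off the edge `i` collapses to an end of the segment, so fibres over inner points are
singletons. -/
theorem IsTree.eq_of_proj_eq (hG : G.IsTree) {i : I} {x y : G.Point}
    (hl : hG.proj i x ≠ G.left i) (hr : hG.proj i x ≠ G.right i)
    (hxy : hG.proj i x = hG.proj i y) : x = y := by
  obtain ⟨s, rfl⟩ : ∃ s : Set.Icc (G.left i) (G.right i), x = G.pt i s := by
    simpa [hl, hr] using hG.exists_eq_pt_or i x
  obtain ⟨t, rfl⟩ : ∃ t : Set.Icc (G.left i) (G.right i), y = G.pt i t := by
    simpa [← hxy, hl, hr] using hG.exists_eq_pt_or i y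
  rw [hG.proj_pt_self, hG.proj_pt_self] at hxy
  rw [Subtype.ext hxy]

/-- Only the moves along the edge `i` change the projection, each by its own length. -/
theorem IsTree.abs_proj_sub_proj_le (hG : G.IsTree) (i : I) {x y : G.Point} {L : ℝ}
    (h : G.Joined x y L) : |hG.proj i x - hG.proj i y| ≤ L := by
  induction h with
  | refl => simp
  | step j s t L _ ih =>
    refine (abs_sub_le _ (hG.proj i (G.pt j s)) _).trans (add_le_add ih ?_)
    by_cases hji : j = i
    · subst hji
      rw [hG.proj_pt_self, hG.proj_pt_self]
      exact le_of_eq rfl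
    · rw [hG.proj_pt_of_ne hji s t, sub_self, abs_zero]
      exact dist_nonneg

/-- Any two distinct points of a tree are separated by the retraction onto an edge that contains
the first of them. -/
theorem IsTree.exists_proj_ne (hG : G.IsTree) {a x : G.Point} (hx : x ≠ a) :
    ∃ (i : I) (t : Set.Icc (G.left i) (G.right i)), a = G.pt i t ∧ hG.proj i x ≠ t := by
  obtain ⟨L, hL⟩ := exists_joined_of_preconnected hG.isTree_skeleton.1.1 a x
  induction hL with
  | refl => exact absurd rfl hx
  | step j s s' L _ ih =>
    -- The edge sought is that of the last move starting at `a`: later moves on other edges keep the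
    -- projection, and on this edge the value `t` is taken only at `a`.
    by_cases hs : G.pt j s = a
    · refine ⟨j, s, hs.symm, fun h => hx ?_⟩
      rw [hG.proj_pt_self] at h
      rw [← hs, Subtype.ext h]
    · obtain ⟨i, t, rfl, ht⟩ := ih hs
      refine ⟨i, t, rfl, fun h => ?_⟩
      by_cases hji : j = i
      · subst hji
        rw [hG.proj_pt_self] at h
        exact hx (by rw [Subtype.ext h])
      · exact ht (by rw [hG.proj_pt_of_ne hji s s', h])

end GluedGraph

/-! ### Separation by inner points of paths, and connectedness -/

namespace MetricTree

variable {I : Type u} {T : MetricTree I}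

theorem dist_le_of_joined {x y : T.Point} {L : ℝ} (h : T.toGluedGraph.Joined x y L) :
    dist x y ≤ L :=
  csInf_le ⟨0, fun _ h => h.nonneg⟩ h

theorem le_dist_of_forall_joined {x y : T.Point} {r : ℝ}
    (h : ∀ L, T.toGluedGraph.Joined x y L → r ≤ L) : r ≤ dist x y :=
  le_csInf (GluedGraph.exists_joined_of_preconnected T.isTree.isTree_skeleton.1.1 x y) h

/-- The image in the tree of the point `s` of the `i`-th segment. -/
def pt (T : MetricTree I) (i : I) (s : Set.Icc (T.left i) (T.right i)) : T.Point :=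
  T.toGluedGraph.pt i s

theorem dist_pt_le (i : I) (s t : Set.Icc (T.left i) (T.right i)) :
    dist (T.pt i s) (T.pt i t) ≤ dist s t :=
  dist_le_of_joined (GluedGraph.Joined.edge i s t)

theorem continuous_pt (i : I) : Continuous (T.pt i) :=
  (LipschitzWith.of_dist_le_mul (K := 1) fun s t => by simpa using dist_pt_le i s t).continuous

/-- The retraction of the tree onto its edge `i`, with values in the `i`-th segment. -/
noncomputable def proj (T : MetricTree I) (i : I) : T.Point → ℝ := T.isTree.proj i

theorem continuous_proj (i : I) : Continuous (T.proj i) :=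
  (LipschitzWith.of_dist_le_mul (K := 1) fun x y => by
    rw [NNReal.coe_one, one_mul]
    exact le_dist_of_forall_joined fun L h => T.isTree.abs_proj_sub_proj_le i h).continuous

/-- A point `a` separates the set where `g` is positive from its complement, if the broken lines
can only leave this set through `a`. -/
theorem dist_add_dist_le_of_forall_edge {a : T.Point} {g : T.Point → ℝ}
    (hg : ∀ j s s', 0 < g (T.pt j s) → g (T.pt j s') ≤ 0 →
      dist (T.pt j s) a + dist a (T.pt j s') ≤ dist s s') {x y : T.Point}
    (hx : 0 < g x) (hy : g y ≤ 0) : dist x a + dist a y ≤ dist x y := by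
  refine le_dist_of_forall_joined fun L h => ?_
  induction h with
  | refl => exact absurd hx hy.not_gt
  | step j s s' L hL ih =>
    change dist x a + dist a (T.pt j s') ≤ _
    -- Either the line has already left the positive set, or its last move leaves it and can be
    -- routed through `a`.
    rcases le_or_gt (g (T.pt j s)) 0 with hs | hs
    · have h1 : dist x a + dist a (T.pt j s) ≤ L := ih hs
      linarith [dist_triangle a (T.pt j s) (T.pt j s'), dist_pt_le j s s']
    · have h1 : dist x (T.pt j s) ≤ L := dist_le_of_joined hL
      linarith [hg j s s' hs hy, dist_triangle x (T.pt j s) a]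

/-- A path that passes through a point where `g` vanishes cannot come back to the set where `g`
is positive, if `g` is injective on the part of this set near its boundary. -/
theorem nonpos_of_path {g : T.Point → ℝ} (hg : Continuous g) {ε : ℝ} (hε : 0 < ε)
    (hinj : ∀ x y, 0 < g x → g x < ε → g x = g y → x = y) {γ : unitInterval → T.Point}
    (hγ : Continuous γ) (hγi : Function.Injective γ) {s : unitInterval} (hs : g (γ s) = 0)
    (h0 : 0 < g (γ 0)) : g (γ 1) ≤ 0 := by
  by_contra! h1
  -- The level `h` is low enough to be attained both before and after `s`, and, being below `ε`, at
  -- only one point of the tree.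
  set h := min (ε / 2) (min (g (γ 0)) (g (γ 1))) with hh
  have hpos : 0 < h := lt_min (half_pos hε) (lt_min h0 h1)
  have hc : Continuous (g ∘ γ) := hg.comp hγ
  obtain ⟨t₁, ht₁, e₁⟩ := intermediate_value_Icc' (unitInterval.nonneg' (t := s)) hc.continuousOn
    (show h ∈ Set.Icc _ _ from ⟨hs.trans_le hpos.le, (min_le_right _ _).trans (min_le_left _ _)⟩)
  obtain ⟨t₂, ht₂, e₂⟩ := intermediate_value_Icc (unitInterval.le_one' (t := s)) hc.continuousOn
    (show h ∈ Set.Icc _ _ from ⟨hs.trans_le hpos.le, (min_le_right _ _).trans (min_le_right _ _)⟩)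
  simp only [Function.comp_apply] at e₁ e₂
  have e : t₁ = t₂ := hγi (hinj _ _ (e₁ ▸ hpos)
    (by rw [e₁]; exact (min_le_left _ _).trans_lt (half_lt_self hε)) (e₁.trans e₂.symm))
  have : t₁ = s := le_antisymm ht₁.2 (e ▸ ht₂.1)
  rw [this, hs] at e₁
  exact hpos.ne e₁

/-- An inner point of a path separates the tree, with the ends of the path in different parts. -/
theorem exists_separation {γ : unitInterval → T.Point} (hγ : Continuous γ)
    (hγi : Function.Injective γ) {a : T.Point} (ha : a ∈ Set.range γ) (h0 : γ 0 ≠ a) :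
    ∃ U : Set T.Point, γ 0 ∈ U ∧ γ 1 ∉ U ∧
      ∀ x ∈ U, ∀ y ∉ U, dist x a + dist a y ≤ dist x y := by
  obtain ⟨s, hs⟩ := ha
  -- If `a` is a vertex, many edges may meet there; the one chosen leads towards `γ 0`.
  obtain ⟨i, t, hat, hne⟩ := T.isTree.exists_proj_ne h0
  have hat : a = T.pt i t := hat
  have hne : T.proj i (γ 0) ≠ t := hne
  have hps : ∀ s, T.proj i (T.pt i s) = s := T.isTree.proj_pt_self i
  have hpa : T.proj i a = t := by rw [hat, hps]
  have hpj : ∀ j ≠ i, ∀ s s', T.proj i (T.pt j s) = T.proj i (T.pt j s') :=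
    fun j hj s s' => T.isTree.proj_pt_of_ne hj s s'
  have hinj : ∀ x y, T.left i < T.proj i x → T.proj i x < T.right i →
    T.proj i x = T.proj i y → x = y := fun x y hl hr => T.isTree.eq_of_proj_eq hl.ne' hr.ne
  have hrange : ∀ x, T.left i ≤ T.proj i x ∧ T.proj i x ≤ T.right i := by
    intro x
    obtain ⟨s, hs⟩ | h | h := T.isTree.exists_eq_pt_or i x
    · have : T.proj i x = s := (congrArg (T.proj i) hs).trans (hps s)
      rw [this]
      exact s.2
    · exact ⟨h.ge, h.trans_le (T.left_lt_right i).le⟩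
    · exact ⟨(T.left_lt_right i).le.trans h.ge, h.le⟩
  have hedge : ∀ s s', dist (T.pt i s) a + dist a (T.pt i s') ≤ |(s : ℝ) - t| + |(t : ℝ) - s'| :=
    fun s s' => by
      rw [hat]
      exact add_le_add (dist_pt_le i s t) (dist_pt_le i t s')
  have key : ∀ (g : T.Point → ℝ) (ε : ℝ), Continuous g → 0 < ε →
      (∀ x y, 0 < g x → g x < ε → g x = g y → x = y) → g a = 0 → 0 < g (γ 0) →
      (∀ j s s', 0 < g (T.pt j s) → g (T.pt j s') ≤ 0 →
        dist (T.pt j s) a + dist a (T.pt j s') ≤ dist s s') →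
      ∃ U : Set T.Point, γ 0 ∈ U ∧ γ 1 ∉ U ∧
        ∀ x ∈ U, ∀ y ∉ U, dist x a + dist a y ≤ dist x y := by
    intro g ε hg hε hi hga hg0 hgs
    refine ⟨{x | 0 < g x}, hg0, ?_, fun x hx y hy => ?_⟩
    · exact (nonpos_of_path hg hε hi hγ hγi (hs.symm ▸ hga) hg0).not_gt
    · exact dist_add_dist_le_of_forall_edge hgs hx (not_lt.1 hy)
  rcases lt_or_gt_of_ne hne with hlt | hlt
  -- With this `ε`, the condition `0 < g < ε` keeps the projection strictly inside the segment,
  -- where fibres are singletons.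
  · refine key (fun x => t - T.proj i x) (t - T.left i)
      (continuous_const.sub (continuous_proj i)) (by linarith [(hrange (γ 0)).1])
      (fun x y hx hx' hxy => hinj x y (by linarith) (by linarith [t.2.2]) (by linarith))
      (by simp [hpa]) (by linarith) ?_
    intro j s s' h h'
    by_cases hj : j = i
    · subst hj
      rw [hps] at h h'
      refine (hedge s s').trans ?_
      rw [Subtype.dist_eq, Real.dist_eq, abs_of_nonpos (by linarith : (s : ℝ) - t ≤ 0),
        abs_of_nonpos (by linarith : (t : ℝ) - s' ≤ 0),
        abs_of_nonpos (by linarith : (s : ℝ) - s' ≤ 0)]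
      linarith
    · rw [hpj j hj s s'] at h
      linarith
  · refine key (fun x => T.proj i x - t) (T.right i - t)
      ((continuous_proj i).sub continuous_const) (by linarith [(hrange (γ 0)).2])
      (fun x y hx hx' hxy => hinj x y (by linarith [t.2.1]) (by linarith) (by linarith))
      (by simp [hpa]) (by linarith) ?_
    intro j s s' h h'
    by_cases hj : j = i
    · subst hj
      rw [hps] at h h'
      refine (hedge s s').trans ?_
      rw [Subtype.dist_eq, Real.dist_eq, abs_of_nonneg (by linarith : 0 ≤ (s : ℝ) - t),
        abs_of_nonneg (by linarith : 0 ≤ (t : ℝ) - s'),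
        abs_of_nonneg (by linarith : 0 ≤ (s : ℝ) - s')]
      linarith
    · rw [hpj j hj s s'] at h
      linarith

/-- A metric tree is connected in the sense that a non-empty set that contains with each point
its `ε`-neighbourhood is the whole tree. -/
theorem mem_of_forall_dist_lt {A : Set T.Point} {ε : ℝ} (hε : 0 < ε)
    (hA : ∀ x ∈ A, ∀ y, dist x y < ε → y ∈ A) {x : T.Point} (hx : x ∈ A) (y : T.Point) :
    y ∈ A := by
  obtain ⟨L, hL⟩ := GluedGraph.exists_joined_of_preconnected T.isTree.isTree_skeleton.1.1 x y
  have hopen : IsOpen A := Metric.isOpen_iff.2 fun x hx =>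
    ⟨ε, hε, fun y hy => hA x hx y (by rw [dist_comm]; exact hy)⟩
  have hclosed : IsOpen Aᶜ := Metric.isOpen_iff.2 fun x hx =>
    ⟨ε, hε, fun y hy hy' => hx (hA y hy' x hy)⟩
  induction hL with
  | refl => exact hx
  | step i s t L _ ih =>
    -- A clopen set contains all or nothing of a segment, so membership propagates along the broken
    -- line.
    have hcl : IsClopen (T.pt i ⁻¹' A) :=
      IsClopen.preimage ⟨isOpen_compl_iff.1 hclosed, hopen⟩ (continuous_pt i)
    have : PreconnectedSpace (Set.Icc (T.left i) (T.right i)) :=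
      Subtype.preconnectedSpace isPreconnected_Icc
    have hu := hcl.eq_univ ⟨s, ih⟩
    exact (Set.eq_univ_iff_forall.1 hu t : T.pt i t ∈ A)

end MetricTree

/-! ### Distortion and the upper bound -/

theorem ofReal_abs_sub_le_distortion {X : Type u} {Y : Type v} [PseudoMetricSpace X]
    [PseudoMetricSpace Y] {R : Set (X × Y)} {p q : X × Y} (hp : p ∈ R) (hq : q ∈ R) :
    ENNReal.ofReal |dist p.1 q.1 - dist p.2 q.2| ≤ distortion R :=
  (le_iSup₂ (f := fun q (_ : q ∈ R) => ENNReal.ofReal |dist p.1 q.1 - dist p.2 q.2|) q hq).trans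
    (le_iSup₂ (f := fun p (_ : p ∈ R) =>
      ⨆ q ∈ R, ENNReal.ofReal |dist p.1 q.1 - dist p.2 q.2|) p hp)

theorem gromovHausdorffEDist_le_hausdorffEDist {Z : Type u} [PseudoMetricSpace Z] (X : Set Z) :
    gromovHausdorffEDist X Z ≤ Metric.hausdorffEDist X Set.univ := by
  refine le_of_forall_gt fun r hr => ?_
  -- Nearest points need not exist; the slack `d` above the Hausdorff distance gives every point a
  -- partner closer than `d`.
  obtain ⟨d, hd, hdr⟩ := exists_between hr
  let R : Set (X × Z) := {p | edist (p.1 : Z) p.2 < d}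
  have hR : IsCorrespondence R := by
    refine ⟨fun x => ⟨x, ?_⟩, fun y => ?_⟩
    · change edist (x : Z) x < d
      rw [edist_self]
      exact bot_le.trans_lt hd
    · obtain ⟨x, hx, h⟩ := Metric.exists_edist_lt_of_hausdorffEDist_lt (Set.mem_univ y)
        (Metric.hausdorffEDist_comm.trans_lt hd)
      exact ⟨⟨x, hx⟩, by rw [edist_comm] at h; exact h⟩
  have hdis : distortion R ≤ d * 2 := by
    refine iSup₂_le fun p hp => iSup₂_le fun q hq => ?_
    have h : |dist p.1 q.1 - dist p.2 q.2| ≤ dist (p.1 : Z) p.2 + dist (q.1 : Z) q.2 := by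
      rw [Subtype.dist_eq, ← Real.dist_eq]
      exact dist_dist_dist_le _ _ _ _
    calc ENNReal.ofReal |dist p.1 q.1 - dist p.2 q.2|
        ≤ ENNReal.ofReal (dist (p.1 : Z) p.2 + dist (q.1 : Z) q.2) := ENNReal.ofReal_le_ofReal h
      _ = edist (p.1 : Z) p.2 + edist (q.1 : Z) q.2 := by
        rw [ENNReal.ofReal_add dist_nonneg dist_nonneg, ← edist_dist, ← edist_dist]
      _ ≤ d * 2 := by
        rw [mul_two]
        exact add_le_add (le_of_lt hp) (le_of_lt hq)
  calc gromovHausdorffEDist X Z ≤ distortion R / 2 :=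
        ENNReal.div_le_div_right (iInf₂_le R hR) 2
    _ ≤ d := ENNReal.div_le_of_le_mul hdis
    _ < r := hdr

/-! ### The lower bound -/

namespace MetricTree

variable {I : Type u} {T : MetricTree I}

theorem infEDist_mul_two_le_distortion {X : Set T.Point} {a : T.Point} (ha : a ∈ relInterior X)
    {R : Set (X × T.Point)} (hR : IsCorrespondence R) :
    Metric.infEDist a X * 2 ≤ distortion R := by
  by_contra! hlt
  obtain ⟨haX, γ, hγ, h0, h1, hmem⟩ := ha
  obtain ⟨U, hU0, hU1, hU⟩ := exists_separation hγ.continuous hγ.injective hmem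
    (ne_of_mem_of_not_mem h0 haX)
  have hfin : Metric.infEDist a X ≠ ⊤ := Metric.infEDist_ne_top ⟨_, h0⟩
  have hlt' : (distortion R).toReal < Metric.infDist a X * 2 := by
    have := (ENNReal.toReal_lt_toReal hlt.ne_top (ENNReal.mul_ne_top hfin (by simp))).2 hlt
    rwa [ENNReal.toReal_mul, ENNReal.toReal_ofNat] at this
  have hdis : ∀ p ∈ R, ∀ q ∈ R, dist p.1 q.1 ≤ (distortion R).toReal + dist p.2 q.2 := by
    intro p hp q hq
    have := (ENNReal.ofReal_le_iff_le_toReal hlt.ne_top).1 (ofReal_abs_sub_le_distortion hp hq)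
    linarith [(abs_le.1 this).2]
  have hfar : ∀ x ∈ X, ∀ y ∈ X, x ∈ U → y ∉ U → Metric.infDist a X * 2 ≤ dist x y := by
    intro x hx y hy hxU hyU
    have h1 := Metric.infDist_le_dist_of_mem hx (x := a)
    have h2 := Metric.infDist_le_dist_of_mem hy (x := a)
    rw [dist_comm] at h1
    linarith [hU x hxU y hyU]
  -- The radius is the gap between the two sides of `X` minus the distortion: partners of points
  -- this close cannot lie on different sides.
  have hstep : ∀ (x y : X) (z w : T.Point), (x, z) ∈ R → (y, w) ∈ R → (x : T.Point) ∈ U →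
      dist z w < Metric.infDist a X * 2 - (distortion R).toReal → (y : T.Point) ∈ U := by
    intro x y z w hxz hyw hx hzw
    by_contra hy
    have h1 := hfar x x.2 y y.2 hx hy
    have h2 : dist (x : T.Point) y ≤ _ := hdis _ hxz _ hyw
    linarith
  obtain ⟨z, hz⟩ := hR.1 ⟨γ 0, h0⟩
  obtain ⟨w, hw⟩ := hR.1 ⟨γ 1, h1⟩
  obtain ⟨x, hxU, hx⟩ : w ∈ {w | ∃ x : X, (x : T.Point) ∈ U ∧ (x, w) ∈ R} := by
    refine mem_of_forall_dist_lt (sub_pos.2 hlt') ?_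
      (show z ∈ {w | ∃ x : X, (x : T.Point) ∈ U ∧ (x, w) ∈ R} from ⟨⟨γ 0, h0⟩, hU0, hz⟩) w
    rintro p ⟨x, hxU, hx⟩ q hpq
    obtain ⟨y, hy⟩ := hR.2 q
    exact ⟨y, hstep x y p q hx hy hxU hpq, hy⟩
  -- Now `w` is matched both to `x` in `U` and to `γ 1` outside it.
  refine hU1 (hstep x ⟨γ 1, h1⟩ w w hx hw hxU ?_)
  rw [dist_self]
  exact sub_pos.2 hlt'

end MetricTree

theorem mainTheorem1 {I : Type u} (T : MetricTree I) (X : Set T.Point) (hX : X.Nonempty)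
    (h : MetricTree.relBoundary X = ∅ ∨
      (MetricTree.relBoundary X ≠ ∅ ∧
        Metric.hausdorffEDist X Set.univ >
          orientedHausdorffEDist (MetricTree.relBoundary X) X)) :
    gromovHausdorffEDist X T.Point = Metric.hausdorffEDist X Set.univ := by
  refine le_antisymm (gromovHausdorffEDist_le_hausdorffEDist X) ?_
  refine (ENNReal.le_div_iff_mul_le (by simp) (by simp)).2 (le_iInf₂ fun R hR => ?_)
  by_contra! hlt
  have hlt' : distortion R / 2 < Metric.hausdorffEDist X Set.univ :=
    ENNReal.div_lt_of_lt_mul hlt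
  have hdiv : ∀ a, Metric.infEDist a X ≤ distortion R / 2 ∨ a ∈ MetricTree.relBoundary X := by
    intro a
    by_cases haX : a ∈ X
    · exact Or.inl (by simp [Metric.infEDist_zero_of_mem haX])
    by_cases ha : a ∈ MetricTree.relInterior X
    · exact Or.inl ((ENNReal.le_div_iff_mul_le (by simp) (by simp)).2
        (MetricTree.infEDist_mul_two_le_distortion ha hR))
    · exact Or.inr ⟨haX, ha⟩
  have hbound : Metric.hausdorffEDist X Set.univ ≤
      max (distortion R / 2) (orientedHausdorffEDist (MetricTree.relBoundary X) X) := by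
    refine Metric.hausdorffEDist_le_of_infEDist (fun x _ => ?_) fun a _ => ?_
    · simp [Metric.infEDist_zero_of_mem (Set.mem_univ x)]
    · exact (hdiv a).elim (fun h => h.trans (le_max_left _ _))
        fun h => (le_iSup₂ (f := fun a (_ : a ∈ MetricTree.relBoundary X) =>
          Metric.infEDist a X) a h).trans (le_max_right _ _)
  have hboundary : orientedHausdorffEDist (MetricTree.relBoundary X) X <
      Metric.hausdorffEDist X Set.univ := by
    rcases h with h | h
    · rw [h, orientedHausdorffEDist]
      -- The supremum over the empty set is `0`, and `hlt'` makes the Hausdorff distance positive.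
      simpa using bot_le.trans_lt hlt'
    · exact h.2
  exact (max_lt hlt' hboundary).not_ge hbound
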